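/- For a set $S$ in a Euclidean space, let $N(S,\epsilon)$ be the minimum number of closed Euclidean balls of radius $\epsilon$ needed to cover $S$, and let $$\mathrm{boxdim}(S)=\limsup_{\epsilon\to 0^+}\frac{\log N(S,\epsilon)}{-\log \epsilon}$$ be its upper box-counting dimension. Let $n,m\ge 0$ and $G\ge 1$ be integers, let $k$ be a real number, and let $\mathcal X\subseteq\mathbb R^n$ be either (a) a bounded set with $\mathrm{boxdim}(\mathcal X)=k$, or (b) an unbounded conic set (that is, $cx\in\mathcal X$ for all $x\in\mathcal X$ and $c>0$) whose intersection with the Euclidean unit sphere has upper box-counting dimension $k-1$. Suppose that $m>k+n/G$. Then for Lebesgue-almost every tuple $(A_1,\dots,A_G)\in(\mathbb R^{m\times n})^G$ the model $\mathcal X$ is uniquely identified by the measurement sets $A_g\mathcal X=\{A_gx : x\in\mathcal X\}$, $g=1,\dots,G$, in the following sense: the inferred set $$\hat{\mathcal X}=\{v\in\mathbb R^n : \text{there are } x_1,\dots,x_G\in\mathcal X \text{ with } A_g(x_g-v)=0 \text{ for all } g=1,\dots,G\}$$ equals $\mathcal X$; moreover, every set $\mathcal X'\subseteq\mathbb R^n$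 with $A_g\mathcal X'=A_g\mathcal X$ for all $g$ equals $\mathcal X$. -/

import Mathlib

open MeasureTheory Filter Topology
open scoped NNReal ENNReal Matrix

/-- The upper box-counting dimension of a set `S`: the limit superior, as `ε → 0⁺`, of
`log N(S, ε) / (- log ε)`, where `N(S, ε)` is the minimal number of closed balls of radius `ε`
needed to cover `S`. It takes values in the extended reals; the empty set has dimension `-∞`. -/
noncomputable def upperBoxDim {E : Type*} [PseudoEMetricSpace E] (S : Set E) : EReal :=
  limsup (fun ε : ℝ≥0 =>
    ENNReal.log ((Metric.externalCoveringNumber ε S : ℕ∞) : ℝ≥0∞) /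
      ((-Real.log (ε : ℝ) : ℝ) : EReal)) (𝓝[>] 0)

/-- A set closed under multiplication by positive scalars. -/
def IsConic {n : ℕ} (X : Set (EuclideanSpace ℝ (Fin n))) : Prop :=
  ∀ c : ℝ, 0 < c → ∀ x ∈ X, c • x ∈ X

/-- The low-dimensionality assumption on the signal set: `X` is either bounded with box-counting
dimension `k`, or an unbounded conic set whose intersection with the Euclidean unit sphere has
box-counting dimension `k - 1`. -/
def IsSignalModel {n : ℕ} (X : Set (EuclideanSpace ℝ (Fin n))) (k : ℝ) : Prop :=
  (Bornology.IsBounded X ∧ upperBoxDim X = (k : EReal)) ∨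
  (¬ Bornology.IsBounded X ∧ IsConic X ∧
    upperBoxDim (X ∩ Metric.sphere (0 : EuclideanSpace ℝ (Fin n)) 1) = ((k - 1 : ℝ) : EReal))

/-- The measurement set `A X = {A x | x ∈ X}` of one operator. -/
def measurementSet {m n : ℕ} (A : Matrix (Fin m) (Fin n) ℝ)
    (X : Set (EuclideanSpace ℝ (Fin n))) : Set (Fin m → ℝ) :=
  {y | ∃ x ∈ X, A *ᵥ x.ofLp = y}

/-- The inferred signal set: all `v` such that `A_g (x_g - v) = 0` for all `g`, for some choice of
`x_1, …, x_G ∈ X`. -/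
def inferredSet {G m n : ℕ} (A : Fin G → Matrix (Fin m) (Fin n) ℝ)
    (X : Set (EuclideanSpace ℝ (Fin n))) : Set (EuclideanSpace ℝ (Fin n)) :=
  {v | ∃ x : Fin G → EuclideanSpace ℝ (Fin n),
    (∀ g, x g ∈ X) ∧ ∀ g, A g *ᵥ (x g - v).ofLp = 0}

/-! A bad tuple of matrices kills nonzero differences `w g = x g - v` for all `g` simultaneously.
With `x` ranging over `X ^ G` and `v` over a ball, these `w` form a set of dimension at most about
`G * k + n`, so `ε`-balls covering it number about `ε ^ (-(G * k + n))`. If every `w g` is bounded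
away from zero, the bounded matrices that nearly kill one centre satisfy `G * m` independent slab
conditions and have volume `O(ε ^ (G * m))` (`volume_slab_le`). Since `G * k + n < G * m`, the union
bound tends to zero (`volume_setOf_exists_dotProduct_eq_zero`), and a countable exhaustion removes
the bounds. Hence almost surely some `x g` equals `v`. One index suffices, because it already puts
`v` in `X`. -/

/-! ### Polynomial covering bounds -/

/-- For small `ε`, the set `S` is covered by `K ε⁻ᵈ` closed balls of radius `ε`. -/
def PolyCover {E : Type*} [PseudoMetricSpace E] (S : Set E) (d : ℝ) : Prop :=
  ∃ K : ℝ, 0 < K ∧ ∀ᶠ ε : ℝ in 𝓝[>] 0, ∃ F : Finset E,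
    (F.card : ℝ) ≤ K * ε ^ (-d) ∧ ∀ x ∈ S, ∃ y ∈ F, dist x y ≤ ε

theorem PolyCover.of_upperBoxDim_lt {E : Type*} [PseudoMetricSpace E] {S : Set E} {d : ℝ}
    (h : upperBoxDim S < (d : EReal)) : PolyCover S d := by
  refine ⟨1, one_pos, ?_⟩
  have h1 := eventually_lt_of_limsup_lt h
  have ht : Tendsto Real.toNNReal (𝓝[>] (0 : ℝ)) (𝓝[>] (0 : ℝ≥0)) := by
    refine tendsto_nhdsWithin_iff.2 ⟨?_, ?_⟩
    · have := (continuous_real_toNNReal.tendsto (0 : ℝ)).mono_left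
        (nhdsWithin_le_nhds (s := Set.Ioi (0 : ℝ)))
      simpa using this
    · filter_upwards [self_mem_nhdsWithin] with x hx
      simpa using hx
  filter_upwards [ht.eventually h1, Ioo_mem_nhdsGT (one_pos : (0 : ℝ) < 1)] with ε hε hε1
  have hpos : 0 < -Real.log ε := neg_pos.2 (Real.log_neg hε1.1 hε1.2)
  rw [Real.coe_toNNReal _ hε1.1.le, EReal.div_lt_iff (by exact_mod_cast hpos)
    (EReal.coe_ne_top _), ← EReal.coe_mul] at hε
  have he : d * -Real.log ε = Real.log (ε ^ (-d)) := by
    rw [Real.log_rpow hε1.1]; ring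
  have hp : 0 < ε ^ (-d) := Real.rpow_pos_of_pos hε1.1 _
  rw [he, ← ENNReal.log_ofReal_of_pos hp, ENNReal.log_lt_log_iff] at hε
  -- The infimum defining the covering number is attained, as `ℕ∞` is well-ordered.
  obtain ⟨r, hr1, hr2⟩ : ∃ C : Set E, Metric.IsCover ε.toNNReal S C ∧
      C.encard ≤ Metric.externalCoveringNumber ε.toNNReal S := by
    have hne : {c : ℕ∞ | ∃ C : Set E, Metric.IsCover ε.toNNReal S C ∧ C.encard = c}.Nonempty :=
      ⟨_, S, Metric.IsCover.rfl, rfl⟩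
    obtain ⟨C, hC, hCe⟩ := csInf_mem hne
    refine ⟨C, hC, ?_⟩
    rw [hCe]
    exact le_iInf₂ fun C' hC' => sInf_le ⟨C', hC', rfl⟩
  have hfin : r.Finite := by
    rw [← Set.encard_lt_top_iff]
    refine lt_of_le_of_lt hr2 ?_
    rw [← ENat.toENNReal_lt, ENat.toENNReal_top]
    exact hε.trans ENNReal.ofReal_lt_top
  refine ⟨hfin.toFinset, ?_, fun x hx => ?_⟩
  · have h2 : ((hfin.toFinset.card : ℕ) : ℝ≥0∞) ≤ ENNReal.ofReal (ε ^ (-d)) := by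
      refine le_trans ?_ hε.le
      rw [← ENat.toENNReal_coe, ENat.toENNReal_le, ← hfin.encard_eq_coe_toFinset_card]
      exact hr2
    rw [one_mul]
    rw [← ENNReal.ofReal_natCast] at h2
    exact (ENNReal.ofReal_le_ofReal_iff hp.le).1 h2
  · rw [Metric.isCover_iff_subset_iUnion_closedBall] at hr1
    have := hr1 hx
    simp only [Set.mem_iUnion, Metric.mem_closedBall] at this
    obtain ⟨y, hy, hxy⟩ := this
    rw [Real.coe_toNNReal _ hε1.1.le] at hxy
    exact ⟨y, by simpa using hy, hxy⟩

theorem PolyCover.mono {E : Type*} [PseudoMetricSpace E] {S T : Set E} {d : ℝ}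
    (h : PolyCover T d) (hST : S ⊆ T) : PolyCover S d := by
  obtain ⟨K, hK, h⟩ := h
  refine ⟨K, hK, h.mono ?_⟩
  rintro ε ⟨F, hF, hc⟩
  exact ⟨F, hF, fun x hx => hc x (hST hx)⟩

theorem PolyCover.prod {E E' : Type*} [PseudoMetricSpace E] [PseudoMetricSpace E']
    {S : Set E} {T : Set E'} {d e : ℝ} (hS : PolyCover S d) (hT : PolyCover T e) :
    PolyCover (S ×ˢ T) (d + e) := by
  obtain ⟨K, hK, hS⟩ := hS
  obtain ⟨L, hL, hT⟩ := hT
  refine ⟨K * L, mul_pos hK hL, ?_⟩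
  filter_upwards [hS, hT, self_mem_nhdsWithin] with ε hS hT hε
  obtain ⟨F, hF, hc⟩ := hS
  obtain ⟨F', hF', hc'⟩ := hT
  refine ⟨F ×ˢ F', ?_, ?_⟩
  · rw [Finset.card_product, Nat.cast_mul, neg_add, Real.rpow_add hε]
    calc (F.card : ℝ) * F'.card ≤ (K * ε ^ (-d)) * (L * ε ^ (-e)) :=
          mul_le_mul hF hF' (Nat.cast_nonneg _) ((Nat.cast_nonneg _).trans hF)
      _ = _ := by ring
  · rintro ⟨x, x'⟩ ⟨hx, hx'⟩
    obtain ⟨y, hy, hxy⟩ := hc x hx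
    obtain ⟨y', hy', hxy'⟩ := hc' x' hx'
    exact ⟨(y, y'), Finset.mk_mem_product hy hy', max_le hxy hxy'⟩

theorem PolyCover.pi {ι E : Type*} [Fintype ι] [PseudoMetricSpace E] {S : Set E} {d : ℝ}
    (hS : PolyCover S d) :
    PolyCover (Set.univ.pi fun _ : ι => S) (Fintype.card ι * d) := by
  classical
  obtain ⟨K, hK, hS⟩ := hS
  refine ⟨K ^ Fintype.card ι, pow_pos hK _, ?_⟩
  filter_upwards [hS, self_mem_nhdsWithin] with ε hS hε
  obtain ⟨F, hF, hc⟩ := hS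
  refine ⟨Fintype.piFinset fun _ => F, ?_, fun x hx => ?_⟩
  · have hε' : (0 : ℝ) < ε := hε
    rw [Fintype.card_piFinset, Finset.prod_const, Finset.card_univ, Nat.cast_pow,
      neg_mul_eq_mul_neg, mul_comm (_ : ℝ) (-d),
      Real.rpow_mul_natCast hε'.le, ← mul_pow]
    gcongr
  · choose y hy hxy using fun i => hc (x i) (hx i trivial)
    exact ⟨y, by simpa using hy, (dist_pi_le_iff (le_of_lt hε)).2 hxy⟩

/-- The point `y` is not required to lie in `S` because covering centres need not; the restriction
to distance at most 1 admits maps such as scalar multiplication that are only locally Lipschitz. -/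
theorem PolyCover.image {E E' : Type*} [PseudoMetricSpace E] [PseudoMetricSpace E']
    {S : Set E} {d : ℝ} (hS : PolyCover S d) {f : E → E'} {L : ℝ} (hL : 0 < L)
    (hf : ∀ x ∈ S, ∀ y, dist x y ≤ 1 → dist (f x) (f y) ≤ L * dist x y) :
    PolyCover (f '' S) d := by
  classical
  obtain ⟨K, hK, hS⟩ := hS
  refine ⟨K * L⁻¹ ^ (-d), by positivity, ?_⟩
  have ht : Tendsto (fun ε : ℝ => L⁻¹ * ε) (𝓝[>] (0 : ℝ)) (𝓝[>] (0 : ℝ)) := by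
    refine tendsto_nhdsWithin_iff.2 ⟨?_, ?_⟩
    · have : Tendsto (fun ε : ℝ => L⁻¹ * ε) (𝓝 0) (𝓝 (L⁻¹ * 0)) :=
        (continuous_const.mul continuous_id).tendsto 0
      rw [mul_zero] at this
      exact this.mono_left nhdsWithin_le_nhds
    · filter_upwards [self_mem_nhdsWithin] with x hx
      exact mul_pos (inv_pos.2 hL) hx
  filter_upwards [ht.eventually hS, ht.eventually (Ioo_mem_nhdsGT (one_pos : (0 : ℝ) < 1)),
    self_mem_nhdsWithin] with ε hS hε1 hε
  obtain ⟨F, hF, hc⟩ := hS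
  refine ⟨F.image f, ?_, ?_⟩
  · refine (Nat.cast_le.2 Finset.card_image_le).trans (hF.trans_eq ?_)
    rw [Real.mul_rpow (by positivity) (le_of_lt hε), mul_assoc]
  · rintro _ ⟨x, hx, rfl⟩
    obtain ⟨y, hy, hxy⟩ := hc x hx
    refine ⟨f y, Finset.mem_image_of_mem f hy, (hf x hx y (hxy.trans hε1.2.le)).trans ?_⟩
    calc L * dist x y ≤ L * (L⁻¹ * ε) := by gcongr
      _ = ε := by field_simp

theorem polyCover_closedBall_real {R : ℝ} (hR : 0 ≤ R) :
    PolyCover (Metric.closedBall (0 : ℝ) R) 1 := by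
  classical
  refine ⟨2 * R + 3, by positivity, ?_⟩
  filter_upwards [Ioo_mem_nhdsGT (one_pos : (0 : ℝ) < 1)] with ε hε
  have h0 : 0 < ε := hε.1
  refine ⟨(Finset.Icc (-⌈R / ε⌉) ⌈R / ε⌉).image fun i : ℤ => (i : ℝ) * ε, ?_, ?_⟩
  · refine (Nat.cast_le.2 Finset.card_image_le).trans ?_
    have hN : 0 ≤ ⌈R / ε⌉ := Int.ceil_nonneg (by positivity)
    have h1 : (((Finset.Icc (-⌈R / ε⌉) ⌈R / ε⌉).card : ℤ) : ℝ) = 2 * ⌈R / ε⌉ + 1 := by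
      rw [Int.card_Icc, Int.toNat_of_nonneg (by linarith)]
      push_cast; ring
    rw [Int.cast_natCast] at h1
    rw [h1, Real.rpow_neg_one]
    have h2 := (Int.ceil_lt_add_one (R / ε)).le
    have h3 : 1 ≤ ε⁻¹ := (one_le_inv₀ h0).2 hε.2.le
    rw [div_eq_mul_inv] at h2 ⊢
    linarith
  · intro t ht
    rw [mem_closedBall_zero_iff, Real.norm_eq_abs, abs_le] at ht
    refine ⟨⌊t / ε⌋ * ε, Finset.mem_image_of_mem _ (Finset.mem_Icc.2 ⟨?_, ?_⟩), ?_⟩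
    · rw [← Int.floor_neg, ← neg_div]
      exact Int.floor_le_floor (by gcongr; exact ht.1)
    · exact (Int.floor_le_ceil _).trans (Int.ceil_le_ceil (by gcongr; exact ht.2))
    · have h1 := Int.floor_le (t / ε)
      have h2 := Int.lt_floor_add_one (t / ε)
      rw [le_div_iff₀ h0] at h1
      rw [div_lt_iff₀ h0] at h2
      rw [Real.dist_eq, abs_le]
      constructor <;> linarith

theorem polyCover_closedBall_pi {n : ℕ} {R : ℝ} (hR : 0 ≤ R) :
    PolyCover (Metric.closedBall (0 : Fin n → ℝ) R) n := by
  have := (polyCover_closedBall_real hR).pi (ι := Fin n)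
  rw [Fintype.card_fin, mul_one] at this
  refine this.mono fun x hx i _ => ?_
  rw [mem_closedBall_zero_iff] at hx ⊢
  exact (norm_le_pi_norm x i).trans hx

/-! ### Volumes of slabs -/

/-- Some coordinate satisfies `δ ≤ |w j|`. Replacing the `j`-th coordinate of `r` by `r ⬝ᵥ w` is a
linear map of determinant `w j` that sends the slab into a box. The truncated exponent is harmless:
`hw` forces `n ≥ 1`. -/
theorem volume_slab_le {n : ℕ} {w : Fin n → ℝ} {δ M η : ℝ} (hδ : 0 < δ) (hM : 0 ≤ M)
    (hη : 0 ≤ η) (hw : δ ≤ ‖w‖) :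
    volume {r : Fin n → ℝ | ‖r‖ ≤ M ∧ |r ⬝ᵥ w| ≤ η} ≤
      ENNReal.ofReal ((2 * M) ^ (n - 1) * 2 / δ * η) := by
  obtain ⟨j, hj⟩ : ∃ j, δ ≤ |w j| := by
    by_contra! h
    exact absurd hw (not_le.2 ((pi_norm_lt_iff hδ).2 h))
  have hwj : 0 < |w j| := hδ.trans_le hj
  set L : (Fin n → ℝ) →ₗ[ℝ] (Fin n → ℝ) :=
    Matrix.toLin' ((1 : Matrix (Fin n) (Fin n) ℝ).updateCol j w)ᵀ with hL
  have hdet : LinearMap.det L = w j := by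
    rw [hL, LinearMap.det_toLin', Matrix.det_transpose, ← Matrix.cramer_apply, Matrix.cramer_one]
    rfl
  have himg := Measure.addHaar_image_linearMap volume L
    {r : Fin n → ℝ | ‖r‖ ≤ M ∧ |r ⬝ᵥ w| ≤ η}
  rw [hdet] at himg
  have hsub : L '' {r : Fin n → ℝ | ‖r‖ ≤ M ∧ |r ⬝ᵥ w| ≤ η} ⊆
      Set.univ.pi fun i => if i = j then Set.Icc (-η) η else Set.Icc (-M) M := by
    rintro _ ⟨r, ⟨hr, hrw⟩, rfl⟩ i -
    have hLi : L r i = if i = j then r ⬝ᵥ w else r i := by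
      simp only [hL, Matrix.toLin'_apply, Matrix.mulVec, dotProduct, Matrix.transpose_apply,
        Matrix.updateCol_apply]
      split_ifs
      · simp [mul_comm]
      · simp [Matrix.one_apply]
    dsimp only
    rw [hLi]
    split_ifs
    · exact abs_le.1 hrw
    · exact abs_le.1 ((norm_le_pi_norm r i).trans hr)
  have hvol := (himg.symm.le).trans (measure_mono hsub)
  rw [volume_pi_pi] at hvol
  have hprod : ∏ i : Fin n, volume (if i = j then Set.Icc (-η) η else Set.Icc (-M) M) =
      ENNReal.ofReal ((2 * M) ^ (n - 1) * (2 * η)) := by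
    rw [← Finset.mul_prod_erase _ _ (Finset.mem_univ j), if_pos rfl,
      Finset.prod_congr rfl (g := fun _ => ENNReal.ofReal (2 * M))]
    · rw [Finset.prod_const, Finset.card_erase_of_mem (Finset.mem_univ j), Finset.card_univ,
        Fintype.card_fin, Real.volume_Icc, ← ENNReal.ofReal_pow (by positivity), mul_comm,
        ← ENNReal.ofReal_mul (by positivity)]
      ring_nf
    · intro i hi
      rw [if_neg (Finset.ne_of_mem_erase hi), Real.volume_Icc]
      ring_nf
  rw [hprod] at hvol
  have h1 : volume {r : Fin n → ℝ | ‖r‖ ≤ M ∧ |r ⬝ᵥ w| ≤ η} ≤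
      ENNReal.ofReal ((2 * M) ^ (n - 1) * (2 * η)) / ENNReal.ofReal |w j| := by
    rw [ENNReal.le_div_iff_mul_le (Or.inl (by simpa using abs_pos.1 hwj)) (Or.inl (by simp)),
      mul_comm]
    exact hvol
  refine h1.trans ?_
  rw [← ENNReal.ofReal_div_of_pos hwj]
  refine ENNReal.ofReal_le_ofReal ?_
  calc (2 * M) ^ (n - 1) * (2 * η) / |w j| ≤ (2 * M) ^ (n - 1) * (2 * η) / δ := by gcongr
    _ = _ := by ring

theorem abs_dotProduct_le {n : ℕ} (r u : Fin n → ℝ) : |r ⬝ᵥ u| ≤ n * (‖r‖ * ‖u‖) := by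
  refine (Finset.abs_sum_le_sum_abs _ _).trans ?_
  refine (Finset.sum_le_card_nsmul _ _ (‖r‖ * ‖u‖) fun i _ => ?_).trans_eq ?_
  · rw [abs_mul]
    exact mul_le_mul (norm_le_pi_norm r i) (norm_le_pi_norm u i) (abs_nonneg _) (norm_nonneg _)
  · rw [Finset.card_univ, Fintype.card_fin, nsmul_eq_mul]

theorem volume_pi_slab_le {G m n : ℕ} {w : Fin G → Fin n → ℝ} {δ M η : ℝ} (hδ : 0 < δ)
    (hM : 0 ≤ M) (hη : 0 ≤ η) (hw : ∀ g, δ ≤ ‖w g‖) :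
    volume {a : Fin G → Fin m → Fin n → ℝ | ∀ g i, ‖a g i‖ ≤ M ∧ |a g i ⬝ᵥ w g| ≤ η} ≤
      ENNReal.ofReal (((2 * M) ^ (n - 1) * 2 / δ * η) ^ (G * m)) := by
  have h1 : {a : Fin G → Fin m → Fin n → ℝ | ∀ g i, ‖a g i‖ ≤ M ∧ |a g i ⬝ᵥ w g| ≤ η} =
      Set.univ.pi fun g => Set.univ.pi fun _ => {r | ‖r‖ ≤ M ∧ |r ⬝ᵥ w g| ≤ η} := by
    ext a
    simp [Set.mem_pi]
  rw [h1, volume_pi_pi]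
  simp_rw [volume_pi_pi]
  refine (Finset.prod_le_prod' fun g _ => Finset.prod_le_prod' fun i _ =>
    volume_slab_le hδ hM hη (hw g)).trans_eq ?_
  simp only [Finset.prod_const, Finset.card_univ, Fintype.card_fin]
  rw [← pow_mul, ← ENNReal.ofReal_pow (by positivity), mul_comm m G]

/-! ### The union bound -/

/-- Almost no bounded tuple of matrices annihilates an element of a family `W` of tuples of
vectors that are bounded away from zero, if the dimension of `W` is below the number of rows. -/
theorem volume_setOf_exists_dotProduct_eq_zero {G m n : ℕ} {W : Set (Fin G → Fin n → ℝ)}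
    {D δ M : ℝ} (hW : PolyCover W D) (hD : D < G * m) (hδ : 0 < δ) (hM : 0 ≤ M)
    (hWδ : ∀ w ∈ W, ∀ g, δ ≤ ‖w g‖) :
    volume {a : Fin G → Fin m → Fin n → ℝ |
      (∀ g i, ‖a g i‖ ≤ M) ∧ ∃ w ∈ W, ∀ g i, a g i ⬝ᵥ w g = 0} = 0 := by
  classical
  obtain ⟨K, hK, hW⟩ := hW
  set C : ℝ := (2 * M) ^ (n - 1) * 2 / (δ / 2) * (n * M) with hC
  have hC0 : 0 ≤ C := by positivity
  have hlim : Tendsto (fun ε : ℝ => ENNReal.ofReal (K * C ^ (G * m) * ε ^ ((G * m : ℝ) - D)))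
      (𝓝[>] 0) (𝓝 0) := by
    have h1 : Tendsto (fun ε : ℝ => K * C ^ (G * m) * ε ^ ((G * m : ℝ) - D))
        (𝓝 0) (𝓝 (K * C ^ (G * m) * 0 ^ ((G * m : ℝ) - D))) :=
      ((Real.continuousAt_rpow_const 0 _ (Or.inr (by linarith))).tendsto).const_mul _
    rw [Real.zero_rpow (by linarith), mul_zero] at h1
    simpa using (ENNReal.tendsto_ofReal h1).mono_left nhdsWithin_le_nhds
  refine le_antisymm (ge_of_tendsto hlim ?_) zero_le
  filter_upwards [hW, Ioo_mem_nhdsGT (half_pos hδ)] with ε hW hε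
  obtain ⟨F, hF, hc⟩ := hW
  have h0 : 0 < ε := hε.1
  have hsub : {a : Fin G → Fin m → Fin n → ℝ |
      (∀ g i, ‖a g i‖ ≤ M) ∧ ∃ w ∈ W, ∀ g i, a g i ⬝ᵥ w g = 0} ⊆
      -- A centre within `ε < δ / 2` of a point of `W` keeps all components of norm at least `δ /
      -- 2`, so the other centres can be dropped.
      ⋃ y ∈ F.filter (fun y => ∀ g, δ / 2 ≤ ‖y g‖),
        {a | ∀ g i, ‖a g i‖ ≤ M ∧ |a g i ⬝ᵥ y g| ≤ n * M * ε} := by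
    rintro a ⟨ha, w, hw, haw⟩
    obtain ⟨y, hy, hwy⟩ := hc w hw
    have hg : ∀ g, ‖y g - w g‖ ≤ ε := fun g => by
      rw [← dist_eq_norm, dist_comm]
      exact (dist_le_pi_dist w y g).trans hwy
    simp only [Set.mem_iUnion, Finset.mem_filter]
    refine ⟨y, ⟨hy, fun g => ?_⟩, fun g i => ⟨ha g i, ?_⟩⟩
    · have h1 := hWδ w hw g
      have h2 := norm_sub_norm_le (w g) (y g)
      rw [norm_sub_rev] at h2
      linarith [hg g, hε.2]
    · have h1 : a g i ⬝ᵥ y g = a g i ⬝ᵥ (y g - w g) := by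
        rw [dotProduct_sub, haw, sub_zero]
      rw [h1, mul_assoc]
      refine (abs_dotProduct_le _ _).trans ?_
      gcongr
      exacts [ha g i, hg g]
  calc _ ≤ _ := measure_mono hsub
    _ ≤ ∑ y ∈ F.filter (fun y => ∀ g, δ / 2 ≤ ‖y g‖),
        volume {a : Fin G → Fin m → Fin n → ℝ |
          ∀ g i, ‖a g i‖ ≤ M ∧ |a g i ⬝ᵥ y g| ≤ n * M * ε} := measure_biUnion_finset_le _ _
    _ ≤ ∑ y ∈ F.filter (fun y => ∀ g, δ / 2 ≤ ‖y g‖), ENNReal.ofReal ((C * ε) ^ (G * m)) := by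
        refine Finset.sum_le_sum fun y hy => ?_
        refine (volume_pi_slab_le (half_pos hδ) hM (by positivity)
          (Finset.mem_filter.1 hy).2).trans_eq ?_
        rw [hC]
        ring_nf
    _ ≤ F.card • ENNReal.ofReal ((C * ε) ^ (G * m)) := by
        rw [Finset.sum_const]
        exact nsmul_le_nsmul_left zero_le (Finset.card_filter_le _ _)
    _ = ENNReal.ofReal (F.card * (C * ε) ^ (G * m)) := by
        rw [nsmul_eq_mul, ENNReal.ofReal_mul (Nat.cast_nonneg _), ENNReal.ofReal_natCast]
    _ ≤ _ := by
        refine ENNReal.ofReal_le_ofReal ?_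
        calc (F.card : ℝ) * (C * ε) ^ (G * m) ≤ K * ε ^ (-D) * (C * ε) ^ (G * m) := by gcongr
          _ = _ := by
            rw [sub_eq_add_neg, Real.rpow_add h0, ← Nat.cast_mul, Real.rpow_natCast, mul_pow]
            ring

theorem volume_setOf_exists_mulVec_sub_eq_zero {G m n : ℕ} (hG : 0 < G)
    {X : Set (EuclideanSpace ℝ (Fin n))} {d δ M R : ℝ} (hX : PolyCover X d)
    (hd : d + (n : ℝ) / G < m) (hδ : 0 < δ) (hM : 0 ≤ M) (hR : 0 ≤ R) :
    volume {a : Fin G → Fin m → Fin n → ℝ | (∀ g i, ‖a g i‖ ≤ M) ∧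
      ∃ (x : Fin G → EuclideanSpace ℝ (Fin n)) (v : Fin n → ℝ), (∀ g, x g ∈ X) ∧ ‖v‖ ≤ R ∧
        (∀ g, δ ≤ ‖(x g).ofLp - v‖) ∧ ∀ g i, a g i ⬝ᵥ ((x g).ofLp - v) = 0} = 0 := by
  have hG' : (0 : ℝ) < G := Nat.cast_pos.2 hG
  set f : (Fin G → EuclideanSpace ℝ (Fin n)) × (Fin n → ℝ) → Fin G → Fin n → ℝ :=
    fun p g => (p.1 g).ofLp - p.2 with hf
  have hW := ((hX.pi (ι := Fin G)).prod (polyCover_closedBall_pi (n := n) hR)).image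
    (f := f) (L := 2) two_pos fun p _ q _ => by
      refine (dist_pi_le_iff (by positivity)).2 fun g => ?_
      have h1 : dist (p.1 g).ofLp (q.1 g).ofLp ≤ dist p q := by
        refine le_trans ?_ ((dist_le_pi_dist p.1 q.1 g).trans (le_max_left _ _))
        refine (dist_pi_le_iff dist_nonneg).2 fun i => ?_
        rw [dist_eq_norm, dist_eq_norm]
        exact PiLp.norm_apply_le (p.1 g - q.1 g) i
      have h2 : dist p.2 q.2 ≤ dist p q := le_max_right _ _
      refine (dist_sub_sub_le _ _ _ _).trans ?_
      linarith
  -- This is the dimension hypothesis multiplied by `G`.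
  have hD : (Fintype.card (Fin G) : ℝ) * d + n < G * m := by
    rw [Fintype.card_fin]
    calc (G : ℝ) * d + n = G * (d + n / G) := by field_simp
      _ < G * m := by gcongr
  refine measure_mono_null ?_ (volume_setOf_exists_dotProduct_eq_zero
    (hW.mono (Set.inter_subset_left (t := {w : Fin G → Fin n → ℝ | ∀ g, δ ≤ ‖w g‖})))
    hD hδ hM fun w hw => hw.2)
  rintro a ⟨ha, x, v, hx, hv, hxv, h0⟩
  exact ⟨ha, f (x, v), ⟨⟨(x, v), ⟨fun g _ => hx g, by simpa using hv⟩, rfl⟩, hxv⟩, h0⟩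

/-! ### Covers of signal models -/

/-- In polar coordinates the truncated cone lies in the image of an interval times its spherical
section, and the radius adds one dimension. `hne` supplies a direction to represent the origin. -/
theorem PolyCover.inter_closedBall_of_isConic {n : ℕ} {X : Set (EuclideanSpace ℝ (Fin n))}
    (hX : IsConic X) {d : ℝ} (hd : PolyCover (X ∩ Metric.sphere 0 1) d)
    (hne : (X ∩ Metric.sphere 0 1).Nonempty) {R : ℝ} (hR : 0 ≤ R) :
    PolyCover (X ∩ Metric.closedBall 0 R) (1 + d) := by
  have himg := ((polyCover_closedBall_real hR).prod hd).image
    -- `R` bounds the radius, and 2 bounds a centre within distance 1 of a unit vector.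
    (f := fun p : ℝ × EuclideanSpace ℝ (Fin n) => p.1 • p.2) (L := R + 2) (by positivity)
    (by
      rintro ⟨t, x⟩ ⟨ht, hx⟩ ⟨s, y⟩ hxy
      set r := dist (t, x) (s, y)
      have h1 : ‖t - s‖ ≤ r := by
        rw [← dist_eq_norm]; exact le_max_left _ _
      have h2 : ‖x - y‖ ≤ r := by
        rw [← dist_eq_norm]; exact le_max_right _ _
      have hx1 : ‖x‖ = 1 := by simpa using hx.2
      have ht1 : ‖t‖ ≤ R := by simpa using ht
      have hy : ‖y‖ ≤ 2 := by
        have := norm_sub_norm_le y x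
        rw [norm_sub_rev] at this
        linarith
      have he : t • x - s • y = t • (x - y) + (t - s) • y := by
        rw [smul_sub, sub_smul]; abel
      rw [dist_eq_norm, he]
      calc _ ≤ ‖t‖ * ‖x - y‖ + ‖t - s‖ * ‖y‖ := by
            rw [← norm_smul, ← norm_smul]; exact norm_add_le _ _
        _ ≤ R * r + r * 2 := by gcongr
        _ = _ := by ring)
  refine himg.mono ?_
  rintro x ⟨hx, hxR⟩
  rcases eq_or_ne x 0 with rfl | h0
  · obtain ⟨y, hy⟩ := hne
    exact ⟨(0, y), ⟨by simpa using hR, hy⟩, zero_smul _ _⟩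
  · have hn : 0 < ‖x‖ := norm_pos_iff.2 h0
    refine ⟨(‖x‖, ‖x‖⁻¹ • x), ⟨by simpa using hxR, hX _ (inv_pos.2 hn) x hx, ?_⟩, ?_⟩
    · simp [norm_smul, hn.ne']
    · simp [smul_smul, hn.ne']

theorem IsSignalModel.polyCover {n : ℕ} {X : Set (EuclideanSpace ℝ (Fin n))} {k d R : ℝ}
    (hX : IsSignalModel X k) (hkd : k < d) (hR : 0 ≤ R) :
    PolyCover (X ∩ Metric.closedBall 0 R) d := by
  rcases hX with ⟨-, hk⟩ | ⟨hub, hc, hk⟩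
  · refine (PolyCover.of_upperBoxDim_lt ?_).mono Set.inter_subset_left
    rw [hk]
    exact_mod_cast hkd
  · have hne : (X ∩ Metric.sphere 0 1).Nonempty := by
      by_contra hemp
      refine hub ((Bornology.isBounded_singleton (x := 0)).subset fun x hx => ?_)
      by_contra h0
      have hn : 0 < ‖x‖ := norm_pos_iff.2 h0
      exact hemp ⟨‖x‖⁻¹ • x, hc _ (inv_pos.2 hn) x hx, by simp [norm_smul, hn.ne']⟩
    have h1 : PolyCover (X ∩ Metric.sphere 0 1) (d - 1) := by
      refine PolyCover.of_upperBoxDim_lt ?_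
      rw [hk]
      exact_mod_cast sub_lt_sub_right hkd 1
    simpa using PolyCover.inter_closedBall_of_isConic hc h1 hne hR

/-! ### Exhaustion and identification -/

/-- For almost every tuple of matrices, no vector `v` has, for every `g`, the same `g`-th
measurement as some element of the model other than `v`. -/
theorem ae_forall_exists_eq_of_mulVec_sub_eq_zero {n m G : ℕ} (hG : 0 < G) {k : ℝ}
    {X : Set (EuclideanSpace ℝ (Fin n))} (hX : IsSignalModel X k)
    (hm : k + (n : ℝ) / G < m) :
    ∀ᵐ a : Fin G → Fin m → Fin n → ℝ ∂volume,
      ∀ (x : Fin G → EuclideanSpace ℝ (Fin n)) (v : EuclideanSpace ℝ (Fin n)),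
        (∀ g, x g ∈ X) → (∀ g, Matrix.of (a g) *ᵥ (x g - v).ofLp = 0) → ∃ g, x g = v := by
  obtain ⟨d, hkd, hdm⟩ := exists_between (lt_sub_iff_add_lt.2 hm)
  -- Countably many null sets, with every size bound equal to `N` and separation `1 / (N + 1)`,
  -- exhaust all bad configurations.
  have key := ae_all_iff.2 fun N : ℕ => measure_eq_zero_iff_ae_notMem.1
    (volume_setOf_exists_mulVec_sub_eq_zero hG (hX.polyCover hkd (Nat.cast_nonneg N))
      (lt_sub_iff_add_lt.1 hdm) (Nat.one_div_pos_of_nat (n := N)) (Nat.cast_nonneg N)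
      (Nat.cast_nonneg N))
  filter_upwards [key] with a ha x v hx h0
  by_contra! hne
  have hpos : ∀ g, 0 < ‖(x g).ofLp - v.ofLp‖ := fun g => by
    rw [norm_pos_iff, sub_ne_zero]
    exact fun h => hne g (WithLp.ofLp_injective 2 h)
  have e1 := eventually_all.2 fun g => eventually_all.2 fun i =>
    tendsto_natCast_atTop_atTop.eventually_ge_atTop ‖a g i‖
  have e2 := eventually_all.2 fun g =>
    tendsto_natCast_atTop_atTop.eventually_ge_atTop ‖x g‖
  have e3 := tendsto_natCast_atTop_atTop.eventually_ge_atTop ‖v.ofLp‖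
  have e4 := eventually_all.2 fun g =>
    (tendsto_one_div_add_atTop_nhds_zero_nat (𝕜 := ℝ)).eventually_le_const (hpos g)
  obtain ⟨N, h1, h2, h3, h4⟩ := (e1.and (e2.and (e3.and e4))).exists
  refine ha N ⟨h1, x, v.ofLp, fun g => ⟨hx g, by simpa using h2 g⟩, h3, h4, fun g i => ?_⟩
  exact congrFun (h0 g) i

theorem theorem1 (n m G : ℕ) (hG : 0 < G) (k : ℝ)
    (X : Set (EuclideanSpace ℝ (Fin n))) (hX : IsSignalModel X k)
    (hm : k + (n : ℝ) / (G : ℝ) < (m : ℝ)) :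
    ∀ᵐ a : Fin G → Fin m → Fin n → ℝ ∂volume,
      inferredSet (fun g => Matrix.of (a g)) X = X ∧
      ∀ X' : Set (EuclideanSpace ℝ (Fin n)),
        (∀ g, measurementSet (Matrix.of (a g)) X' = measurementSet (Matrix.of (a g)) X) →
          X' = X := by
  filter_upwards [ae_forall_exists_eq_of_mulVec_sub_eq_zero hG hX hm] with a ha
  refine ⟨?_, fun X' hX' => ?_⟩
  · ext v
    refine ⟨?_, fun hv => ⟨fun _ => v, fun _ => hv, fun g => by simp⟩⟩
    rintro ⟨x, hx, h0⟩
    obtain ⟨g, rfl⟩ := ha x v hx h0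
    exact hx g
  · have hsub : X' ⊆ X := fun v hv => by
      have h1 : ∀ g, ∃ x ∈ X, Matrix.of (a g) *ᵥ x.ofLp = Matrix.of (a g) *ᵥ v.ofLp :=
        fun g => (hX' g).subset ⟨v, hv, rfl⟩
      choose x hx hxv using h1
      obtain ⟨g, rfl⟩ := ha x v hx fun g => by
        rw [WithLp.ofLp_sub, Matrix.mulVec_sub, hxv, sub_self]
      exact hx g
    refine hsub.antisymm fun v hv => ?_
    have h1 : ∀ g, ∃ x ∈ X', Matrix.of (a g) *ᵥ x.ofLp = Matrix.of (a g) *ᵥ v.ofLp :=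
      fun g => (hX' g).superset ⟨v, hv, rfl⟩
    choose x hx hxv using h1
    -- The inclusion `hsub` makes points of `X'` admissible here, and the index found puts `v` in
    -- `X'`.
    obtain ⟨g, rfl⟩ := ha x v (fun g => hsub (hx g)) fun g => by
      rw [WithLp.ofLp_sub, Matrix.mulVec_sub, hxv, sub_self]
    exact hx g
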